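/- Let $T>0$, $x_0\in\mathbb R$ and $0<a_0\le a_1$, and let $c,q:\mathbb R\to\mathbb R$ be (globally) Lipschitz functions with $c(x)<q(x)$ and $q(x)>0$ for all $x\in\mathbb R$. Consider the optimal control problem $$\text{Minimize in }u:\quad \int_0^T\left[c(x(t))u^2(t)+u^3(t)\right]dt$$ subject to $$x'(t)=q(x(t))u^2(t)+u^3(t)\ \text{ in }(0,T),\qquad x(0)=x_0,$$ $$u\in L^\infty(0,T),\qquad u(t)\in[a_0,a_1]\ \text{ for a.e. } t\in(0,T),$$ where the state $x:[0,T]\to\mathbb R$ is absolutely continuous and satisfies the differential equation for almost every $t$. Then the problem has an optimal control: there are an admissible control $u$ and an associated state $x$ such that, for every admissible control $v$ with an associated state $y$, the cost integrals of $(u,x)$ and $(v,y)$ converge and the cost of $(u,x)$ is at most the cost of $(v,y)$. -/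

import Mathlib

open MeasureTheory Set

/-- `u` is an admissible control on `(0, T)` with values in `K`:
`u ∈ L^∞(0, T)` and `u(t) ∈ K` for almost every `t ∈ (0, T)`. -/
def IsAdmissibleControl (T : ℝ) (K : Set ℝ) (u : ℝ → ℝ) : Prop :=
  MemLp u ⊤ (volume.restrict (Ioo 0 T)) ∧
    ∀ᵐ t ∂(volume.restrict (Ioo 0 T)), u t ∈ K

/-- `x` is a state associated with the control `u`, i.e. a solution (in the sense of
Carathéodory) of `x'(t) = f (x(t), u(t))` in `(0, T)`, `x(0) = x₀`: it is absolutely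
continuous on `[0, T]` and satisfies the equation almost everywhere. -/
def IsState (T : ℝ) (f : ℝ → ℝ → ℝ) (x₀ : ℝ) (u x : ℝ → ℝ) : Prop :=
  AbsolutelyContinuousOnInterval x 0 T ∧ x 0 = x₀ ∧
    ∀ᵐ t ∂(volume.restrict (Ioo 0 T)), HasDerivAt x (f (x t) (u t)) t

/-- The cost `∫₀ᵀ ℓ (x(t), u(t)) dt`. -/
noncomputable def controlCost (T : ℝ) (ℓ : ℝ → ℝ → ℝ) (u x : ℝ → ℝ) : ℝ :=
  ∫ t in (0 : ℝ)..T, ℓ (x t) (u t)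

/-- `u` is an optimal control for the problem of minimizing `∫₀ᵀ ℓ (x, u) dt` subject to
`x' = f (x, u)`, `x(0) = x₀`, `u ∈ L^∞(0, T)`, `u(t) ∈ K`: it is admissible, it has a state `x`
with integrable running cost, and the cost of every other
admissible control with any state associated with it is a convergent integral as well and is
not smaller than the cost of `(u, x)`. -/
def IsOptimalControl (T : ℝ) (K : Set ℝ) (ℓ f : ℝ → ℝ → ℝ) (x₀ : ℝ) (u : ℝ → ℝ) : Prop :=
  IsAdmissibleControl T K u ∧
    ∃ x : ℝ → ℝ, IsState T f x₀ u x ∧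
      IntervalIntegrable (fun t => ℓ (x t) (u t)) volume 0 T ∧
      ∀ v y : ℝ → ℝ, IsAdmissibleControl T K v → IsState T f x₀ v y →
        IntervalIntegrable (fun t => ℓ (y t) (v t)) volume 0 T ∧
          controlCost T ℓ u x ≤ controlCost T ℓ v y

/-! Direct method. Linear growth and Grönwall make all state and cost pairs `(x, J)` equi-Lipschitz,
so a minimizing sequence has a pointwise limit `(X, Y)` along an ultrafilter. It remains to find a
control `u` that drives `X` with running cost at most `Y'`. The set of pairs (velocity, cost) is not
convex, but its lower side is. With `s = v²` the velocity `w = q s + s^(3/2)` is convex and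
increasing in `s`, so `s` is concave in `w`, and the cost `w - (q - c) s` is convex in `w` because
`c < q`. Each tangent line to this convex graph gives a lower bound on `J' - (1 - m) x'`, and such
bounds survive the limit (`le_deriv_of_tendsto`, `cost_ge_tangent`, `velocity_and_cost_of_tendsto`).
Since `q > 0`, the velocity is strictly increasing in the control, so `X'` determines `u`,
measurably (`exists_measurable_selection`). -/

open Filter Topology

/-! ### Absolutely continuous functions and Grönwall estimates -/

/-- A lower bound on the almost everywhere derivative of an absolutely continuous function
integrates to a lower bound on its increments. -/
lemma integral_le_sub_of_ae_le_deriv {T : ℝ} {y h : ℝ → ℝ}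
    (hy : AbsolutelyContinuousOnInterval y 0 T) (hh : IntervalIntegrable h volume 0 T)
    (hd : ∀ᵐ τ ∂(volume.restrict (Ioo 0 T)), ∃ d, HasDerivAt y d τ ∧ h τ ≤ d)
    {s t : ℝ} (hs : 0 ≤ s) (hst : s ≤ t) (ht : t ≤ T) :
    ∫ τ in s..t, h τ ≤ y t - y s := by
  have hsub : uIcc s t ⊆ uIcc 0 T := by
    rw [uIcc_of_le hst, uIcc_of_le (by linarith)]
    exact Icc_subset_Icc hs ht
  have hy' := hy.mono hsub
  rw [← hy'.integral_deriv_eq_sub]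
  refine intervalIntegral.integral_mono_ae_restrict hst (hh.mono_set hsub)
    hy'.intervalIntegrable_deriv ?_
  rw [restrict_Ioo_eq_restrict_Icc] at hd
  filter_upwards [ae_restrict_of_ae_restrict_of_subset (Icc_subset_Icc hs ht) hd] with τ hτ
  obtain ⟨d, hd, hle⟩ := hτ
  rwa [hd.deriv]

lemma abs_sub_le_integral_of_ae_abs_deriv_le {T : ℝ} {y h : ℝ → ℝ}
    (hy : AbsolutelyContinuousOnInterval y 0 T) (hh : IntervalIntegrable h volume 0 T)
    (hd : ∀ᵐ τ ∂(volume.restrict (Ioo 0 T)), ∃ d, HasDerivAt y d τ ∧ |d| ≤ h τ)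
    {s t : ℝ} (hs : 0 ≤ s) (hst : s ≤ t) (ht : t ≤ T) :
    |y t - y s| ≤ ∫ τ in s..t, h τ := by
  rw [abs_le]
  constructor
  · rw [← intervalIntegral.integral_neg]
    refine integral_le_sub_of_ae_le_deriv hy hh.neg ?_ hs hst ht
    filter_upwards [hd] with τ ⟨d, hd, hle⟩
    exact ⟨d, hd, by simpa using neg_le_of_abs_le hle⟩
  · have := integral_le_sub_of_ae_le_deriv (y := fun t => - y t) hy.neg hh.neg ?_ hs hst ht
    · simp only [Pi.neg_apply, intervalIntegral.integral_neg] at this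
      linarith
    · filter_upwards [hd] with τ ⟨d, hd, hle⟩
      exact ⟨-d, hd.neg, by simpa using (le_abs_self d).trans hle⟩

/-- **Grönwall's inequality** for absolutely continuous functions. -/
lemma abs_sub_le_gronwallBound_of_ae {T A B : ℝ} (hA : 0 ≤ A) (hB : 0 ≤ B) {y : ℝ → ℝ}
    (hy : AbsolutelyContinuousOnInterval y 0 T)
    (hd : ∀ᵐ τ ∂(volume.restrict (Ioo 0 T)),
      ∃ d, HasDerivAt y d τ ∧ |d| ≤ A + B * |y τ - y 0|)
    {t : ℝ} (ht : t ∈ Icc 0 T) :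
    |y t - y 0| ≤ gronwallBound 0 B A t := by
  have hT : 0 ≤ T := ht.1.trans ht.2
  have hyc : ContinuousOn y (Icc 0 T) := uIcc_of_le hT ▸ hy.continuousOn
  -- A continuous extension of `y` to the line makes `φ` differentiable everywhere, so the classical
  -- Grönwall inequality applies to `φ`, which dominates `|y - y 0|`.
  set z : ℝ → ℝ := IccExtend hT ((Icc 0 T).domRestrict y) with hz
  have hzc : Continuous z := hyc.domRestrict.Icc_extend'
  have hzy : ∀ s ∈ Icc 0 T, z s = y s := fun s hs => IccExtend_of_mem hT _ hs
  have hcont : Continuous fun τ => A + B * |z τ - y 0| := by fun_prop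
  set φ : ℝ → ℝ := fun s => ∫ τ in (0 : ℝ)..s, (A + B * |z τ - y 0|) with hφ
  have hφd : ∀ s, HasDerivAt φ (A + B * |z s - y 0|) s := fun s =>
    hcont.integral_hasStrictDerivAt 0 s |>.hasDerivAt
  have hle : ∀ s ∈ Icc 0 T, |y s - y 0| ≤ φ s := fun s hs => by
    refine abs_sub_le_integral_of_ae_abs_deriv_le hy (hcont.intervalIntegrable _ _) ?_ le_rfl
      hs.1 hs.2
    filter_upwards [hd, ae_restrict_mem measurableSet_Ioo] with τ ⟨d, hd, hle⟩ hτ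
    exact ⟨d, hd, by rwa [hzy τ (Ioo_subset_Icc_self hτ)]⟩
  have hφ0 : ∀ s ∈ Icc 0 T, 0 ≤ φ s := fun s hs => (abs_nonneg _).trans (hle s hs)
  have key := norm_le_gronwallBound_of_norm_deriv_right_le (f := φ) (δ := 0) (K := B) (ε := A)
    (a := 0) (b := T) (fun s _ => (hφd s).continuousAt.continuousWithinAt)
    (fun s _ => (hφd s).hasDerivWithinAt) (by simp [hφ]) (fun s hs => by
      have hs' := Ico_subset_Icc_self hs
      rw [Real.norm_of_nonneg (by positivity), Real.norm_of_nonneg (hφ0 s hs'), hzy s hs']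
      nlinarith [hle s hs']) t ht
  rw [Real.norm_of_nonneg (hφ0 t ht), sub_zero] at key
  exact (hle t ht).trans key

/-- Global existence for an autonomous scalar equation with a globally Lipschitz right side. -/
lemma exists_hasDerivWithinAt_of_lipschitzWith {F : ℝ → ℝ} {K : NNReal} (hF : LipschitzWith K F)
    {T : ℝ} (hT : 0 ≤ T) (x₀ : ℝ) :
    ∃ x : ℝ → ℝ, x 0 = x₀ ∧ ∀ t ∈ Icc 0 T, HasDerivWithinAt x (F (x t)) (Icc 0 T) t := by
  have hgr : ∀ z, |F z| ≤ |F x₀| + K * |z - x₀| := fun z => by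
    have h1 := hF.dist_le_mul z x₀
    rw [Real.dist_eq, Real.dist_eq] at h1
    have h2 := abs_add_le (F x₀) (F z - F x₀)
    rw [add_sub_cancel] at h2
    linarith
  set R : ℝ := gronwallBound 0 K |F x₀| T with hR
  have hRmono := gronwallBound_mono (δ := 0) (ε := |F x₀|) (K := K) le_rfl (abs_nonneg _) K.2
  have hR0 : 0 ≤ R := by
    have := hRmono hT
    rwa [gronwallBound_x0] at this
  have hR' : x₀ - R ≤ x₀ + R := by linarith
  -- Truncating the state to the a priori ball makes the right side bounded, so Picard–Lindelöf
  -- reaches time `T`. Grönwall then shows that the solution never leaves the ball, where `p` is the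
  -- identity.
  set p : ℝ → ℝ := fun z => projIcc (x₀ - R) (x₀ + R) hR' z with hp
  have hp1 : LipschitzWith 1 p := LipschitzWith.subtype_val _ |>.comp (LipschitzWith.projIcc hR')
    |>.weaken (by simp)
  have hp0 : p x₀ = x₀ := by
    simp only [hp]
    rw [projIcc_of_mem hR' ⟨by linarith, by linarith⟩]
  have hpd : ∀ z, |p z - x₀| ≤ |z - x₀| := fun z => by
    have := hp1.dist_le_mul z x₀
    simpa [Real.dist_eq, hp0] using this
  have hpR : ∀ z, |p z - x₀| ≤ R := fun z => by
    have := (projIcc (x₀ - R) (x₀ + R) hR' z).2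
    rw [abs_le]
    constructor <;> [linarith [this.1]; linarith [this.2]]
  have hG : LipschitzWith K (F ∘ p) := by simpa using hF.comp hp1
  have hPL : IsPicardLindelof (fun _ => F ∘ p) (tmin := 0) (tmax := T) ⟨0, le_rfl, hT⟩ x₀
      (⟨(|F x₀| + K * R) * T, by positivity⟩) 0 ⟨|F x₀| + K * R, by positivity⟩ K := by
    refine .of_time_independent (fun z _ => ?_) hG.lipschitzOnWith ?_
    · refine (hgr (p z)).trans ?_
      have := hpR z
      change _ ≤ |F x₀| + K * R
      gcongr
    · change (|F x₀| + K * R) * max (T - 0) (0 - 0) ≤ (|F x₀| + K * R) * T - 0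
      simp [hT]
  obtain ⟨x, hx0, hx⟩ := hPL.exists_eq_forall_mem_Icc_hasDerivWithinAt₀
  have hx0' : x 0 = x₀ := hx0
  refine ⟨x, hx0, fun t ht => ?_⟩
  have hxc : ContinuousOn x (Icc 0 T) := fun t ht => (hx t ht).continuousWithinAt
  have hb := norm_le_gronwallBound_of_norm_deriv_right_le (f := fun t => x t - x₀)
    (f' := fun t => F (p (x t))) (δ := 0) (K := K) (ε := |F x₀|)
    (a := 0) (b := T) (by fun_prop)
    (fun s hs => ((hx s (Ico_subset_Icc_self hs)).mono_of_mem_nhdsWithin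
      (Icc_mem_nhdsGE_of_mem hs)).sub_const _) (by simp [hx0'])
    (fun s hs => by
      have h1 := hgr (p (x s))
      have h2 := mul_le_mul_of_nonneg_left (hpd (x s)) K.coe_nonneg
      simp only [Real.norm_eq_abs] at *
      linarith) t ht
  rw [sub_zero, Real.norm_eq_abs] at hb
  have hb' := abs_le.mp (hb.trans (hRmono ht.2))
  have : p (x t) = x t := by
    simp only [hp]
    rw [projIcc_of_mem hR' ⟨by linarith [hb'.1], by linarith [hb'.2]⟩]
  simpa [this] using hx t ht

/-! ### Derivative bounds under pointwise limits -/

/-- If `y n → Y` pointwise on `[0, T]`, and near `t₀` the almost everywhere derivative of `y n` is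
at least `h - C |x n - X t₀|`, where the functions `x n` are equi-Lipschitz and
`x n t₀ → X t₀`, then the derivative of `Y` at `t₀` is at least `h`. -/
lemma le_deriv_of_tendsto {ι : Type*} {l : Filter ι} [l.NeBot] {T t₀ M C h ξ d : ℝ} (hC : 0 ≤ C)
    (ht₀ : t₀ ∈ Ioo 0 T) {x y : ι → ℝ → ℝ} {Y : ℝ → ℝ}
    (hx : ∀ i, ∀ t ∈ Icc 0 T, |x i t - x i t₀| ≤ M * |t - t₀|)
    (hxl : Tendsto (fun i => x i t₀) l (𝓝 ξ))
    (hyl : ∀ t ∈ Icc 0 T, Tendsto (fun i => y i t) l (𝓝 (Y t)))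
    (hy : ∀ i, AbsolutelyContinuousOnInterval (y i) 0 T)
    (hd : ∀ i, ∀ᵐ τ ∂(volume.restrict (Ioo 0 T)),
      ∃ d, HasDerivAt (y i) d τ ∧ h - C * |x i τ - ξ| ≤ d)
    (hY : HasDerivAt Y d t₀) : h ≤ d := by
  -- The limit in `i` is taken first, at fixed `t`; the error of order `t - t₀` vanishes afterwards
  -- as `t ↓ t₀`.
  have step : ∀ t ∈ Ioo t₀ T, h - C * (M * (t - t₀)) ≤ (t - t₀)⁻¹ * (Y t - Y t₀) := by
    intro t ht
    have htI : t ∈ Icc 0 T := ⟨by linarith [ht.1, ht₀.1], ht.2.le⟩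
    have htpos : 0 < t - t₀ := by linarith [ht.1]
    have hT : (0 : ℝ) ≤ T := htI.1.trans htI.2
    have hi : ∀ i, (t - t₀) * (h - C * (M * (t - t₀) + |x i t₀ - ξ|)) ≤ y i t - y i t₀ := by
      intro i
      have hM : 0 ≤ M := by
        have := (abs_nonneg _).trans (hx i t htI)
        rw [abs_of_pos htpos] at this
        exact nonneg_of_mul_nonneg_left this htpos
      have hsub : uIcc t₀ t ⊆ uIcc 0 T := by
        rw [uIcc_of_le ht.1.le, uIcc_of_le hT]
        exact Icc_subset_Icc ht₀.1.le ht.2.le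
      rw [← ((hy i).mono hsub).integral_deriv_eq_sub]
      have : (t - t₀) * (h - C * (M * (t - t₀) + |x i t₀ - ξ|)) =
          ∫ _ in t₀..t, (h - C * (M * (t - t₀) + |x i t₀ - ξ|)) := by
        rw [intervalIntegral.integral_const, smul_eq_mul]
      rw [this]
      refine intervalIntegral.integral_mono_ae_restrict ht.1.le intervalIntegrable_const
        ((hy i).mono hsub).intervalIntegrable_deriv ?_
      have hd' := hd i
      rw [restrict_Ioo_eq_restrict_Icc] at hd'
      filter_upwards [ae_restrict_of_ae_restrict_of_subset (Icc_subset_Icc ht₀.1.le ht.2.le) hd',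
        ae_restrict_mem measurableSet_Icc] with τ ⟨e, he, hle⟩ hτ
      rw [he.deriv]
      refine le_trans ?_ hle
      have h1 := hx i τ ⟨ht₀.1.le.trans hτ.1, hτ.2.trans ht.2.le⟩
      rw [abs_of_nonneg (a := τ - t₀) (by linarith [hτ.1])] at h1
      have h2 := abs_sub_le (x i τ) (x i t₀) ξ
      have h3 : M * (τ - t₀) ≤ M * (t - t₀) := by
        gcongr
        exact hτ.2
      gcongr
      linarith
    have hl : Tendsto (fun i => (t - t₀) * (h - C * (M * (t - t₀) + |x i t₀ - ξ|))) l
        (𝓝 ((t - t₀) * (h - C * (M * (t - t₀) + |ξ - ξ|)))) :=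
      (((((hxl.sub_const ξ).abs.const_add _).const_mul C).const_sub h).const_mul _)
    have hlim := le_of_tendsto_of_tendsto' hl ((hyl t htI).sub (hyl t₀ (Ioo_subset_Icc_self ht₀))) hi
    simp only [sub_self, abs_zero, add_zero] at hlim
    rwa [inv_mul_eq_div, le_div_iff₀ htpos, mul_comm]
  have h1 : Tendsto (fun t => (t - t₀)⁻¹ * (Y t - Y t₀)) (𝓝[>] t₀) (𝓝 d) := by
    have := (hasDerivAt_iff_tendsto_slope.mp hY).mono_left
      (nhdsWithin_mono t₀ (s := Ioi t₀) (fun t ht => (mem_Ioi.mp ht).ne'))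
    simpa [slope_fun_def] using this
  have h2 : Tendsto (fun t => h - C * (M * (t - t₀))) (𝓝[>] t₀) (𝓝 (h - C * (M * (t₀ - t₀)))) :=
    ((by fun_prop : Continuous fun t => h - C * (M * (t - t₀))).tendsto t₀).mono_left
      nhdsWithin_le_nhds
  simp only [sub_self, mul_zero, sub_zero] at h2
  refine le_of_tendsto_of_tendsto h2 h1 ?_
  filter_upwards [Ioo_mem_nhdsGT ht₀.2] with t ht using step t ht

/-! ### Trajectories: compactness, and passage to and from controls -/

/-- A trajectory of the differential inclusion `(x', J') ∈ {(f (x, v), ℓ (x, v)) | v ∈ K}` on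
`[0, T]` starting from `(x₀, 0)`. -/
structure IsTrajectory (T : ℝ) (K : Set ℝ) (f ℓ : ℝ → ℝ → ℝ) (x₀ : ℝ) (x J : ℝ → ℝ) : Prop where
  state_ac : AbsolutelyContinuousOnInterval x 0 T
  cost_ac : AbsolutelyContinuousOnInterval J 0 T
  state_zero : x 0 = x₀
  cost_zero : J 0 = 0
  deriv : ∀ᵐ t ∂(volume.restrict (Ioo 0 T)), ∃ v ∈ K,
    HasDerivAt x (f (x t) v) t ∧ HasDerivAt J (ℓ (x t) v) t

/-- Under a linear growth condition all trajectories share a Lipschitz constant. -/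
lemma exists_lipschitzOnWith_of_isTrajectory {T : ℝ} (hT : 0 ≤ T) {K : Set ℝ} {f ℓ : ℝ → ℝ → ℝ}
    {x₀ A B : ℝ} (hA : 0 ≤ A) (hB : 0 ≤ B) (hf : ∀ x, ∀ v ∈ K, |f x v| ≤ A + B * |x - x₀|)
    (hℓ : ∀ x, ∀ v ∈ K, |ℓ x v| ≤ A + B * |x - x₀|) :
    ∃ M : NNReal, ∀ x J, IsTrajectory T K f ℓ x₀ x J →
      LipschitzOnWith M x (Icc 0 T) ∧ LipschitzOnWith M J (Icc 0 T) := by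
  have hmono := gronwallBound_mono (δ := 0) (ε := A) (K := B) le_rfl hA hB
  have hR : 0 ≤ gronwallBound 0 B A T := by
    have := hmono hT
    rwa [gronwallBound_x0] at this
  set R := gronwallBound 0 B A T
  refine ⟨⟨A + B * R, by positivity⟩, fun x J h => ?_⟩
  have hx : ∀ t ∈ Icc 0 T, |x t - x₀| ≤ R := fun t ht => by
    rw [← h.state_zero]
    refine (abs_sub_le_gronwallBound_of_ae hA hB h.state_ac ?_ ht).trans (hmono ht.2)
    filter_upwards [h.deriv] with τ ⟨v, hv, hd, _⟩
    exact ⟨_, hd, h.state_zero ▸ hf _ v hv⟩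
  have key : ∀ y, AbsolutelyContinuousOnInterval y 0 T →
      (∀ᵐ t ∂(volume.restrict (Ioo 0 T)), ∃ d, HasDerivAt y d t ∧ |d| ≤ A + B * |x t - x₀|) →
      LipschitzOnWith ⟨A + B * R, by positivity⟩ y (Icc 0 T) := by
    intro y hy hd
    have hd' : ∀ᵐ t ∂(volume.restrict (Ioo 0 T)), ∃ d, HasDerivAt y d t ∧ |d| ≤ A + B * R := by
      filter_upwards [hd, ae_restrict_mem measurableSet_Ioo] with t ⟨d, hd, hle⟩ ht
      have := hx t (Ioo_subset_Icc_self ht)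
      exact ⟨d, hd, hle.trans (by gcongr)⟩
    refine LipschitzOnWith.of_dist_le_mul fun s hs t ht => ?_
    change |y s - y t| ≤ (A + B * R) * |s - t|
    wlog hst : s ≤ t generalizing s t
    · rw [abs_sub_comm, abs_sub_comm s t]
      exact this t ht s hs (le_of_not_ge hst)
    have := abs_sub_le_integral_of_ae_abs_deriv_le hy intervalIntegrable_const hd' hs.1 hst ht.2
    rw [intervalIntegral.integral_const, smul_eq_mul] at this
    rw [abs_sub_comm, abs_sub_comm s t, abs_of_nonneg (sub_nonneg.mpr hst)]
    linarith
  refine ⟨key x h.state_ac ?_, key J h.cost_ac ?_⟩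
  · filter_upwards [h.deriv] with τ ⟨v, hv, hd, _⟩ using ⟨_, hd, hf _ v hv⟩
  · filter_upwards [h.deriv] with τ ⟨v, hv, _, hd⟩ using ⟨_, hd, hℓ _ v hv⟩

/-- Equi-Lipschitz functions with a common initial value converge pointwise along every
ultrafilter, to a Lipschitz function. -/
lemma exists_tendsto_of_lipschitzOnWith {ι : Type*} (l : Ultrafilter ι) {T : ℝ} (hT : 0 ≤ T)
    {M : NNReal} {y : ι → ℝ → ℝ} {y₀ : ℝ} (hy : ∀ i, LipschitzOnWith M (y i) (Icc 0 T))
    (hy₀ : ∀ i, y i 0 = y₀) :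
    ∃ Y : ℝ → ℝ, LipschitzWith M Y ∧ Y 0 = y₀ ∧
      ∀ t ∈ Icc 0 T, Tendsto (fun i => y i t) l (𝓝 (Y t)) := by
  set p : ℝ → ℝ := fun t => projIcc 0 T hT t with hp
  have hpI : ∀ t, p t ∈ Icc 0 T := fun t => (projIcc 0 T hT t).2
  have hp1 : LipschitzWith 1 p := LipschitzWith.subtype_val _ |>.comp (LipschitzWith.projIcc hT)
    |>.weaken (by simp)
  have hpt : ∀ t ∈ Icc 0 T, p t = t := fun t ht => by
    simp only [hp]
    rw [projIcc_of_mem hT ht]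
  have h0 : (0 : ℝ) ∈ Icc 0 T := ⟨le_rfl, hT⟩
  have hlim : ∀ t, ∃ z, Tendsto (fun i => y i (p t)) l (𝓝 z) := fun t => by
    obtain ⟨z, -, hz⟩ := (isCompact_closedBall y₀ (M * |p t|)).ultrafilter_le_nhds'
      (l.map fun i => y i (p t)) (Ultrafilter.mem_map.mpr <| univ_mem' fun i => by
        have := (hy i).dist_le_mul _ (hpI t) _ h0
        rwa [hy₀, Real.dist_eq (p t), sub_zero] at this)
    exact ⟨z, hz⟩
  choose Y hY using hlim
  refine ⟨Y, LipschitzWith.of_dist_le_mul fun s t => ?_, ?_, fun t ht => hpt t ht ▸ ?_⟩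
  · refine le_of_tendsto ((hY s).dist (hY t)) (Eventually.of_forall fun i => ?_)
    refine ((hy i).dist_le_mul _ (hpI s) _ (hpI t)).trans ?_
    gcongr
    simpa using hp1.dist_le_mul s t
  · have := hY 0
    rw [hpt 0 h0] at this
    simp only [hy₀] at this
    exact tendsto_nhds_unique this tendsto_const_nhds
  · have := hY (p t)
    rwa [hpt _ (hpI t)] at this

/-- Minimizing the terminal cost among the trajectories: there is a minimizing sequence of
trajectories that converges pointwise (along an ultrafilter) to Lipschitz functions. -/
lemma exists_isTrajectory_tendsto {T : ℝ} (hT : 0 ≤ T) {K : Set ℝ} {f ℓ : ℝ → ℝ → ℝ}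
    {x₀ : ℝ} {M : NNReal} (hM : ∀ x J, IsTrajectory T K f ℓ x₀ x J →
      LipschitzOnWith M x (Icc 0 T) ∧ LipschitzOnWith M J (Icc 0 T))
    (hne : ∃ x J, IsTrajectory T K f ℓ x₀ x J) :
    ∃ (x J : ℕ → ℝ → ℝ) (X Y : ℝ → ℝ), (∀ n, IsTrajectory T K f ℓ x₀ (x n) (J n)) ∧
      LipschitzWith M X ∧ LipschitzWith M Y ∧ X 0 = x₀ ∧ Y 0 = 0 ∧
      (∀ t ∈ Icc 0 T, Tendsto (fun n => x n t) (hyperfilter ℕ) (𝓝 (X t))) ∧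
      (∀ t ∈ Icc 0 T, Tendsto (fun n => J n t) (hyperfilter ℕ) (𝓝 (Y t))) ∧
      ∀ x J, IsTrajectory T K f ℓ x₀ x J → Y T ≤ J T := by
  set S : Set ℝ := {r | ∃ x J, IsTrajectory T K f ℓ x₀ x J ∧ J T = r} with hS
  have hSne : S.Nonempty := by
    obtain ⟨x, J, h⟩ := hne
    exact ⟨_, x, J, h, rfl⟩
  have hSb : BddBelow S := by
    refine ⟨-(M * T), ?_⟩
    rintro _ ⟨x, J, h, rfl⟩
    have := (hM x J h).2.dist_le_mul T ⟨hT, le_rfl⟩ 0 ⟨le_rfl, hT⟩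
    rw [h.cost_zero, Real.dist_eq, Real.dist_eq, sub_zero, sub_zero, abs_of_nonneg hT] at this
    exact neg_le_of_abs_le this
  obtain ⟨r, -, hr, hrS⟩ := exists_seq_tendsto_sInf hSne hSb
  choose x J hxJ hJr using hrS
  obtain ⟨X, hXM, hX0, hX⟩ := exists_tendsto_of_lipschitzOnWith (hyperfilter ℕ) hT
    (fun n => (hM _ _ (hxJ n)).1) (fun n => (hxJ n).state_zero)
  obtain ⟨Y, hYM, hY0, hY⟩ := exists_tendsto_of_lipschitzOnWith (hyperfilter ℕ) hT
    (fun n => (hM _ _ (hxJ n)).2) (fun n => (hxJ n).cost_zero)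
  refine ⟨x, J, X, Y, hxJ, hXM, hYM, hX0, hY0, hX, hY, fun x' J' h => ?_⟩
  have h1 := hY T ⟨hT, le_rfl⟩
  simp only [hJr] at h1
  rw [tendsto_nhds_unique h1 (hr.mono_left Nat.hyperfilter_le_atTop)]
  exact csInf_le hSb ⟨x', J', h, rfl⟩

/-- Any state of an admissible control, together with its running cost, is a trajectory. -/
lemma IsState.intervalIntegrable_and_isTrajectory {T : ℝ} (hT : 0 ≤ T) {K : Set ℝ}
    (hK : IsCompact K) {f ℓ : ℝ → ℝ → ℝ} (hℓ : Continuous (Function.uncurry ℓ)) {x₀ : ℝ}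
    {v y : ℝ → ℝ} (hv : IsAdmissibleControl T K v) (hy : IsState T f x₀ v y) :
    IntervalIntegrable (fun t => ℓ (y t) (v t)) volume 0 T ∧
      IsTrajectory T K f ℓ x₀ y (fun t => ∫ s in (0 : ℝ)..t, ℓ (y s) (v s)) := by
  have hyc : ContinuousOn y (Icc 0 T) := uIcc_of_le hT ▸ hy.1.continuousOn
  have hint : IntervalIntegrable (fun t => ℓ (y t) (v t)) volume 0 T := by
    rw [intervalIntegrable_iff_integrableOn_Ioo_of_le hT]
    obtain ⟨D, hD⟩ := ((isCompact_Icc.image_of_continuousOn hyc).prod hK).exists_bound_of_continuousOn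
      hℓ.continuousOn
    have hym : AEStronglyMeasurable y (volume.restrict (Ioo 0 T)) :=
      (hyc.mono Ioo_subset_Icc_self).aestronglyMeasurable measurableSet_Ioo
    refine IntegrableOn.of_bound measure_Ioo_lt_top
      (hℓ.comp_aestronglyMeasurable (hym.prodMk hv.1.1)) D ?_
    filter_upwards [hv.2, ae_restrict_mem measurableSet_Ioo] with t hvt ht
    exact hD (y t, v t) ⟨mem_image_of_mem _ (Ioo_subset_Icc_self ht), hvt⟩
  refine ⟨hint, hy.1, hint.absolutelyContinuousOnInterval_intervalIntegral (by simp), hy.2.1,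
    by simp, ?_⟩
  filter_upwards [hy.2.2, hv.2, ae_restrict_mem measurableSet_Ioo,
    ae_restrict_of_ae hint.ae_hasDerivAt_integral] with t hd hvt ht hi
  exact ⟨v t, hvt, hd, hi (uIcc_of_le hT ▸ Ioo_subset_Icc_self ht) 0 (by simp)⟩

/-- Measurable selection of a solution `u` of `f (X, u) = w` when `f` increases in `u`. -/
lemma exists_measurable_selection {a₀ a₁ : ℝ} (ha : a₀ ≤ a₁) {f : ℝ → ℝ → ℝ}
    (hf : Continuous (Function.uncurry f)) (hmono : ∀ x, StrictMonoOn (f x) (Icc a₀ a₁))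
    {X w : ℝ → ℝ} (hX : Measurable X) (hw : Measurable w) :
    ∃ u : ℝ → ℝ, Measurable u ∧ (∀ t, u t ∈ Icc a₀ a₁) ∧
      ∀ t, w t ∈ Icc (f (X t) a₀) (f (X t) a₁) → f (X t) (u t) = w t := by
  -- Clamping `w` to the attainable range makes the equation solvable at every `t`.
  set W : ℝ → ℝ := fun t => max (f (X t) a₀) (min (w t) (f (X t) a₁)) with hW
  have hfm : ∀ r, Measurable fun t => f (X t) r := fun r =>
    hf.measurable.comp (hX.prodMk measurable_const)
  have hWm : Measurable W := (hfm a₀).max (hw.min (hfm a₁))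
  have h0 : a₀ ∈ Icc a₀ a₁ := ⟨le_rfl, ha⟩
  have h1 : a₁ ∈ Icc a₀ a₁ := ⟨ha, le_rfl⟩
  have hex : ∀ t, ∃ u ∈ Icc a₀ a₁, f (X t) u = W t := fun t => by
    have hc : ContinuousOn (f (X t)) (Icc a₀ a₁) :=
      (hf.comp (by fun_prop : Continuous fun v => (X t, v))).continuousOn
    exact intermediate_value_Icc ha hc
      ⟨le_max_left _ _, max_le ((hmono _).monotoneOn h0 h1 ha) (min_le_right _ _)⟩
  choose u huI hu using hex
  refine ⟨u, measurable_of_Ioi fun r => ?_, huI, fun t ht => ?_⟩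
  -- By strict monotonicity, `u t > r` exactly when `f (X t) r < W t`.
  · by_cases hr : r ∈ Icc a₀ a₁
    · convert measurableSet_lt (hfm r) hWm using 1
      ext t
      simp only [mem_preimage, mem_Ioi, mem_ofPred_eq, ← hu t]
      exact ((hmono (X t)).lt_iff_lt hr (huI t)).symm
    · rcases lt_or_ge r a₀ with h | h
      · convert MeasurableSet.univ using 1
        exact eq_univ_of_forall fun t => h.trans_le (huI t).1
      · convert MeasurableSet.empty using 1
        refine eq_empty_of_forall_notMem fun t ht => hr ⟨h, ?_⟩
        exact (mem_Ioi.mp ht).le.trans (huI t).2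
  · rw [hu t, hW]
    simp [ht.1, ht.2]

/-! ### The cubic data and lower closure -/

lemma abs_mul_sq_add_cube_le {p : ℝ → ℝ} {C : NNReal} (hp : LipschitzWith C p) (x₀ x : ℝ)
    {v a : ℝ} (hv : 0 ≤ v) (hva : v ≤ a) :
    |p x * v ^ 2 + v ^ 3| ≤ |p x₀| * a ^ 2 + a ^ 3 + C * a ^ 2 * |x - x₀| := by
  have h1 := hp.dist_le_mul x x₀
  rw [Real.dist_eq, Real.dist_eq] at h1
  have h2 : |p x| ≤ |p x₀| + C * |x - x₀| := by
    have := abs_add_le (p x₀) (p x - p x₀)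
    rw [add_sub_cancel] at this
    linarith
  calc |p x * v ^ 2 + v ^ 3| ≤ |p x * v ^ 2| + |v ^ 3| := abs_add_le _ _
    _ = |p x| * v ^ 2 + v ^ 3 := by
      rw [abs_mul, abs_of_nonneg (pow_nonneg hv 2), abs_of_nonneg (pow_nonneg hv 3)]
    _ ≤ (|p x₀| + C * |x - x₀|) * a ^ 2 + a ^ 3 := by gcongr
    _ = _ := by ring

/-- The cube lies above its tangents as a function of the square. -/
lemma cube_sub_cube_ge {v r : ℝ} (hv : 0 ≤ v) (hr : 0 ≤ r) :
    3 / 2 * r * (v ^ 2 - r ^ 2) ≤ v ^ 3 - r ^ 3 := by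
  -- The difference of the two sides is `(v - r)² (v + r / 2)`.
  nlinarith [mul_nonneg (sq_nonneg (v - r)) (by positivity : 0 ≤ v + r / 2)]

lemma sub_mul_abs_le_of_lipschitzWith {p : ℝ → ℝ} {C : NNReal} (hp : LipschitzWith C p)
    {x ξ v a : ℝ} (hv : 0 ≤ v) (hva : v ≤ a) :
    |p x * v ^ 2 - p ξ * v ^ 2| ≤ C * a ^ 2 * |x - ξ| := by
  have h1 := hp.dist_le_mul x ξ
  rw [Real.dist_eq, Real.dist_eq] at h1
  rw [← sub_mul, abs_mul, abs_of_nonneg (pow_nonneg hv 2)]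
  calc |p x - p ξ| * v ^ 2 ≤ (C * |x - ξ|) * a ^ 2 := by gcongr
    _ = _ := by ring

/-- Affine minorant of the cost over the velocity, at the control value `r` and the state `ξ`. -/
lemma cost_ge_tangent {c q : ℝ → ℝ} {Cc Cq : NNReal} (hc : LipschitzWith Cc c)
    (hq : LipschitzWith Cq q) {m x ξ v r a : ℝ} (hv : 0 ≤ v) (hva : v ≤ a) (hr : 0 ≤ r)
    (hm : 0 ≤ m) (hmξ : m * (q ξ + 3 / 2 * r) = q ξ - c ξ) :
    (c ξ * r ^ 2 + r ^ 3) - (1 - m) * (q ξ * r ^ 2 + r ^ 3)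
        - (Cc + Cq + m * Cq) * a ^ 2 * |x - ξ| ≤
      (c x * v ^ 2 + v ^ 3) - (1 - m) * (q x * v ^ 2 + v ^ 3) := by
  -- With the state frozen at `ξ`, `hmξ` turns the right side into `m (v³ - 3/2 r v²)`, which is
  -- smallest at `v = r`. The Lipschitz terms pay for the freezing.
  have h1 := (abs_le.mp (sub_mul_abs_le_of_lipschitzWith hc (x := x) (ξ := ξ) hv hva)).1
  have h2 := abs_le.mp (sub_mul_abs_le_of_lipschitzWith hq (x := x) (ξ := ξ) hv hva)
  have h3 := mul_le_mul_of_nonneg_left (cube_sub_cube_ge hv hr) hm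
  have h4 := mul_le_mul_of_nonneg_left h2.1 hm
  have h5 : m * (q ξ + 3 / 2 * r) * (v ^ 2 - r ^ 2) = (q ξ - c ξ) * (v ^ 2 - r ^ 2) := by rw [hmξ]
  linarith [h2.2]

lemma strictMonoOn_mul_sq_add_cube {p a₀ a₁ : ℝ} (hp : 0 < p) (ha₀ : 0 < a₀) :
    StrictMonoOn (fun u : ℝ => p * u ^ 2 + u ^ 3) (Icc a₀ a₁) := by
  intro u hu v hv huv
  have := ha₀.trans_le hu.1
  have h2 : u ^ 2 < v ^ 2 := by gcongr
  have h3 : u ^ 3 < v ^ 3 := by gcongr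
  have := mul_lt_mul_of_pos_left h2 hp
  simp only
  linarith

/-- A constant control is admissible and has a state. -/
lemma exists_isState_const {q : ℝ → ℝ} {Cq : NNReal} (hq : LipschitzWith Cq q) {T : ℝ}
    (hT : 0 ≤ T) (x₀ a : ℝ) :
    ∃ x, IsState T (fun x u => q x * u ^ 2 + u ^ 3) x₀ (fun _ => a) x := by
  have hF : LipschitzWith (Cq * ⟨a ^ 2, sq_nonneg a⟩) fun x => q x * a ^ 2 + a ^ 3 := by
    refine LipschitzWith.of_dist_le_mul fun x y => ?_
    have := hq.dist_le_mul x y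
    rw [Real.dist_eq] at this
    rw [Real.dist_eq, add_sub_add_right_eq_sub, ← sub_mul, abs_mul, abs_of_nonneg (sq_nonneg a)]
    calc |q x - q y| * a ^ 2 ≤ (Cq * dist x y) * a ^ 2 := by gcongr
      _ = Cq * a ^ 2 * dist x y := by ring
  obtain ⟨x, hx0, hx⟩ := exists_hasDerivWithinAt_of_lipschitzWith hF hT x₀
  have hxc : ContinuousOn x (Icc 0 T) := fun t ht => (hx t ht).continuousWithinAt
  obtain ⟨D, hD⟩ := isCompact_Icc.exists_bound_of_continuousOn (hF.continuous.comp_continuousOn hxc)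
  have hL : LipschitzOnWith D.toNNReal x (Icc 0 T) :=
    (convex_Icc 0 T).lipschitzOnWith_of_nnnorm_hasDerivWithin_le hx fun t ht => by
      rw [← NNReal.coe_le_coe, coe_nnnorm]
      exact (hD t ht).trans (Real.le_coe_toNNReal D)
  refine ⟨x, LipschitzOnWith.absolutelyContinuousOnInterval (by rwa [uIcc_of_le hT]), hx0, ?_⟩
  filter_upwards [ae_restrict_mem measurableSet_Ioo] with t ht
  exact (hx t (Ioo_subset_Icc_self ht)).hasDerivAt (Icc_mem_nhds ht.1 ht.2)

/-- Lower closure: at points of differentiability, the velocity of a limit of trajectories is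
attained by a control value whose running cost is not larger than the limit one. -/
lemma velocity_and_cost_of_tendsto {ι : Type*} {l : Filter ι} [l.NeBot] {c q : ℝ → ℝ}
    {Cc Cq : NNReal} (hc : LipschitzWith Cc c) (hq : LipschitzWith Cq q)
    (hcq : ∀ x, c x < q x) (hqpos : ∀ x, 0 < q x) {T x₀ a₀ a₁ : ℝ} (ha₀ : 0 < a₀) (ha : a₀ ≤ a₁)
    {x J : ι → ℝ → ℝ} {X Y : ℝ → ℝ} {M : NNReal}
    (hxJ : ∀ i, IsTrajectory T (Icc a₀ a₁) (fun x u => q x * u ^ 2 + u ^ 3)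
      (fun x u => c x * u ^ 2 + u ^ 3) x₀ (x i) (J i))
    (hxM : ∀ i, LipschitzOnWith M (x i) (Icc 0 T))
    (hX : ∀ t ∈ Icc 0 T, Tendsto (fun i => x i t) l (𝓝 (X t)))
    (hY : ∀ t ∈ Icc 0 T, Tendsto (fun i => J i t) l (𝓝 (Y t)))
    {t : ℝ} (ht : t ∈ Ioo 0 T) {X' Y' : ℝ} (hX' : HasDerivAt X X' t) (hY' : HasDerivAt Y Y' t) :
    X' ∈ Icc (q (X t) * a₀ ^ 2 + a₀ ^ 3) (q (X t) * a₁ ^ 2 + a₁ ^ 3) ∧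
      ∀ r ∈ Icc a₀ a₁, q (X t) * r ^ 2 + r ^ 3 = X' → c (X t) * r ^ 2 + r ^ 3 ≤ Y' := by
  have htI := Ioo_subset_Icc_self ht
  have hxM' : ∀ i, ∀ s ∈ Icc 0 T, |x i s - x i t| ≤ M * |s - t| := fun i s hs =>
    (hxM i).dist_le_mul s hs t htI
  have hmono := strictMonoOn_mul_sq_add_cube (a₁ := a₁) (hqpos (X t)) ha₀
  refine ⟨⟨?_, ?_⟩, fun r hr hrX => ?_⟩
  · refine le_deriv_of_tendsto (C := Cq * a₁ ^ 2) (by positivity) ht hxM' (hX t htI) hX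
      (fun i => (hxJ i).state_ac) (fun i => ?_) hX'
    filter_upwards [(hxJ i).deriv] with τ ⟨v, hv, hd, _⟩
    refine ⟨_, hd, ?_⟩
    have h1 := (abs_le.mp (sub_mul_abs_le_of_lipschitzWith hq (x := x i τ) (ξ := X t)
      (ha₀.le.trans hv.1) hv.2)).1
    have h2 := hmono.monotoneOn ⟨le_rfl, ha⟩ hv hv.1
    linarith
  -- The upper bound on `X'` is the lower bound for `-X`.
  · have := le_deriv_of_tendsto (h := -(q (X t) * a₁ ^ 2 + a₁ ^ 3)) (C := Cq * a₁ ^ 2)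
      (y := fun i s => - x i s) (Y := fun s => - X s)
      (by positivity) ht hxM' (hX t htI) (fun s hs => (hX s hs).neg)
      (fun i => (hxJ i).state_ac.neg) (fun i => ?_) hX'.neg
    · linarith
    filter_upwards [(hxJ i).deriv] with τ ⟨v, hv, hd, _⟩
    refine ⟨_, hd.neg, ?_⟩
    have h1 := (abs_le.mp (sub_mul_abs_le_of_lipschitzWith hq (x := x i τ) (ξ := X t)
      (ha₀.le.trans hv.1) hv.2)).2
    have h2 := hmono.monotoneOn hv ⟨ha, le_rfl⟩ hv.2
    linarith
  · have hr0 : 0 ≤ r := ha₀.le.trans hr.1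
    have hpos : 0 < q (X t) + 3 / 2 * r := by linarith [hqpos (X t)]
    -- At `s = r²`, `dw/ds = q + 3/2 r`, so `1 - m` is the slope of the cost as a function of the
    -- velocity.
    set m : ℝ := (q (X t) - c (X t)) / (q (X t) + 3 / 2 * r) with hm
    have hm0 : 0 ≤ m := div_nonneg (sub_nonneg.mpr (hcq _).le) hpos.le
    have hmξ : m * (q (X t) + 3 / 2 * r) = q (X t) - c (X t) := div_mul_cancel₀ _ hpos.ne'
    have := le_deriv_of_tendsto
      (h := (c (X t) * r ^ 2 + r ^ 3) - (1 - m) * (q (X t) * r ^ 2 + r ^ 3))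
      (C := (Cc + Cq + m * Cq) * a₁ ^ 2)
      (y := fun i s => J i s - (1 - m) * x i s) (Y := fun s => Y s - (1 - m) * X s)
      (by positivity) ht hxM' (hX t htI) (fun s hs => (hY s hs).sub ((hX s hs).const_mul _))
      (fun i => (hxJ i).cost_ac.sub ((hxJ i).state_ac.const_mul _)) (fun i => ?_)
      (hY'.sub (hX'.const_mul _))
    · rw [hrX] at this
      linarith
    filter_upwards [(hxJ i).deriv] with τ ⟨v, hv, hd, hd'⟩
    exact ⟨_, hd'.sub (hd.const_mul _),
      cost_ge_tangent hc hq (ha₀.le.trans hv.1) hv.2 hr0 hm0 hmξ⟩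

theorem lemma7p2 (T : ℝ) (hT : 0 < T) (x₀ a₀ a₁ : ℝ) (ha₀ : 0 < a₀) (ha : a₀ ≤ a₁)
    (c q : ℝ → ℝ) (hc : ∃ C : NNReal, LipschitzWith C c) (hq : ∃ C : NNReal, LipschitzWith C q)
    (hcq : ∀ x, c x < q x) (hqpos : ∀ x, 0 < q x) :
    ∃ u : ℝ → ℝ, IsOptimalControl T (Icc a₀ a₁)
      (fun x u => c x * u ^ 2 + u ^ 3) (fun x u => q x * u ^ 2 + u ^ 3) x₀ u := by
  obtain ⟨Cc, hc⟩ := hc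
  obtain ⟨Cq, hq⟩ := hq
  have hcc := hc.continuous
  have hqc := hq.continuous
  have ha₁ : 0 ≤ a₁ := ha₀.le.trans ha
  have hℓ : Continuous (Function.uncurry fun x u => c x * u ^ 2 + u ^ 3) := by
    unfold Function.uncurry
    fun_prop
  have hf : Continuous (Function.uncurry fun x u => q x * u ^ 2 + u ^ 3) := by
    unfold Function.uncurry
    fun_prop
  have hA : 0 ≤ (|q x₀| + |c x₀|) * a₁ ^ 2 + a₁ ^ 3 := by positivity
  have hB : 0 ≤ (Cq + Cc) * a₁ ^ 2 := by positivity
  have hadm : ∀ u : ℝ → ℝ, Measurable u → (∀ t, u t ∈ Icc a₀ a₁) →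
      IsAdmissibleControl T (Icc a₀ a₁) u := fun u hum huI => by
    refine ⟨memLp_top_of_bound hum.aestronglyMeasurable a₁ (ae_of_all _ fun t => ?_),
      ae_of_all _ huI⟩
    rw [Real.norm_of_nonneg (ha₀.le.trans (huI t).1)]
    exact (huI t).2
  obtain ⟨M, hM⟩ := exists_lipschitzOnWith_of_isTrajectory hT.le (x₀ := x₀) (K := Icc a₀ a₁)
    (f := fun x u => q x * u ^ 2 + u ^ 3) (ℓ := fun x u => c x * u ^ 2 + u ^ 3) hA hB
    (fun x v hv => by
      have := abs_mul_sq_add_cube_le hq x₀ x (ha₀.le.trans hv.1) hv.2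
      have : 0 ≤ |c x₀| * a₁ ^ 2 + Cc * a₁ ^ 2 * |x - x₀| := by positivity
      linarith)
    (fun x v hv => by
      have := abs_mul_sq_add_cube_le hc x₀ x (ha₀.le.trans hv.1) hv.2
      have : 0 ≤ |q x₀| * a₁ ^ 2 + Cq * a₁ ^ 2 * |x - x₀| := by positivity
      linarith)
  obtain ⟨z, hz⟩ := exists_isState_const hq hT.le x₀ a₀
  obtain ⟨x, J, X, Y, hxJ, hXM, hYM, hX0, hY0, hX, hY, hmin⟩ :=
    exists_isTrajectory_tendsto hT.le hM ⟨_, _, (hz.intervalIntegrable_and_isTrajectory hT.le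
      isCompact_Icc hℓ (hadm _ measurable_const fun _ => ⟨le_rfl, ha⟩)).2⟩
  obtain ⟨u, hum, huI, hu⟩ := exists_measurable_selection ha hf
    (fun x => strictMonoOn_mul_sq_add_cube (hqpos x) ha₀) hXM.continuous.measurable
    (measurable_deriv X)
  have hXac := (hXM.lipschitzOnWith (s := uIcc 0 T)).absolutelyContinuousOnInterval
  have hYac := (hYM.lipschitzOnWith (s := uIcc 0 T)).absolutelyContinuousOnInterval
  have hXY : ∀ᵐ t ∂(volume.restrict (Ioo 0 T)),
      HasDerivAt X (q (X t) * u t ^ 2 + u t ^ 3) t ∧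
        ∃ d, HasDerivAt Y d t ∧ c (X t) * u t ^ 2 + u t ^ 3 ≤ d := by
    filter_upwards [ae_restrict_mem measurableSet_Ioo, ae_restrict_of_ae hXac.ae_differentiableAt,
      ae_restrict_of_ae hYac.ae_differentiableAt] with t ht hXt hYt
    have htI : t ∈ uIcc 0 T := uIcc_of_le hT.le ▸ Ioo_subset_Icc_self ht
    have h := velocity_and_cost_of_tendsto hc hq hcq hqpos ha₀ ha hxJ
      (fun n => (hM _ _ (hxJ n)).1) hX hY ht (hXt htI).hasDerivAt (hYt htI).hasDerivAt
    have hut := hu t h.1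
    refine ⟨?_, _, (hYt htI).hasDerivAt, h.2 _ (huI t) hut⟩
    rw [hut]
    exact (hXt htI).hasDerivAt
  have hstate : IsState T (fun x u => q x * u ^ 2 + u ^ 3) x₀ u X :=
    ⟨hXac, hX0, hXY.mono fun t h => h.1⟩
  have hint := (hstate.intervalIntegrable_and_isTrajectory hT.le isCompact_Icc hℓ
    (hadm u hum huI)).1
  refine ⟨u, hadm u hum huI, X, hstate, hint, fun v y hv hy => ?_⟩
  obtain ⟨hvint, htr⟩ := hy.intervalIntegrable_and_isTrajectory hT.le isCompact_Icc hℓ hv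
  refine ⟨hvint, le_trans ?_ (hmin _ _ htr)⟩
  -- `Y` need not be the running cost of `(X, u)`; it suffices that `Y'` dominates it.
  have := integral_le_sub_of_ae_le_deriv hYac hint (hXY.mono fun t h => h.2) le_rfl hT.le le_rfl
  rwa [hY0, sub_zero] at this
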